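/- For \(\Re z>0\) let \(\zeta(s,z)\) denote the Hurwitz zeta function, i.e. the analytic continuation in \(s\) to \(\mathbb C\setminus\{1\}\) of \(\sum_{k\ge 0}(k+z)^{-s}\) (\(\Re s>1\)), and let \(\zeta'(t,z)=\frac{d}{dt}\zeta(t,z)\). Let \(\lambda,r\) be nonnegative integers and put \[ \begin{aligned} S_{\lambda,r}(z)={}&\frac{z^{\lambda+1}}{\lambda+1}\log z-\frac{z^{\lambda}}{2}\log z-\frac{z^{\lambda+1}}{(\lambda+1)^2}\\ &+\sum_{j=1}^{r}\frac{z^{-2j+\lambda+1}}{(2j)!}B_{2j}\sum_{k=0}^{2j-1}(k+1)\left[{2j-1\atop k+1}\right](-\lambda)^k -\log z\sum_{j=1}^{r}\frac{z^{-2j+\lambda+1}B_{2j}\,(-\lambda)_{2j-1}}{(2j)!}, \end{aligned} \] where \(\log\) is the principal branch, \(B_{n}\) are the Bernoulli numbers, \((x)_n=x(x+1)\cdots(x+n-1)\) is the Pochhammer symbol, \((-\lambda)^0=1\) (also for \(\lambda=0\)), and \(\left[{n\atop k}\right]\) are the Stirling cycle numbers, given by \(\left[{n\atop k}\right]=(n-1)\left[{n-1\atop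 k}\right]+\left[{n-1\atop k-1}\right]\) for \(n,k\ge1\), \(\left[{n\atop 0}\right]=1\) if \(n=0\) and \(0\) otherwise, and \(\left[{0\atop k}\right]=0\) for \(k\ge1\). Then, as \(z\to\infty\) in the half-plane \(\Re z>0\) (with an implied constant depending only on \(\lambda\) and \(r\)), \[ \zeta'(-\lambda,z)=S_{\lambda,r}(z)+O\!\left(\frac1{|z|^{2r-\lambda+1}}\right)\quad\text{if } 2r\ge\lambda, \] and \[ \zeta'(-\lambda,z)=S_{\lambda,r}(z)+O\!\left(\frac{\log|z|}{|z|^{2r-\lambda+1}}\right)\quad\text{if } 2r<\lambda . \] -/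

import Mathlib

open Filter Asymptotics Topology

/-- `f` is the Hurwitz zeta function `s ↦ ζ(s, z)`: it is holomorphic on `ℂ \ {1}` and is given by
the series `∑ 1 / (k + z) ^ s` on the half-plane `Re s > 1`. -/
def IsHurwitzContinuation (z : ℂ) (f : ℂ → ℂ) : Prop :=
  DifferentiableOn ℂ f {1}ᶜ ∧
    ∀ s : ℂ, 1 < s.re → HasSum (fun k : ℕ => 1 / ((k : ℂ) + z) ^ s) (f s)

open Classical in
/-- The Hurwitz zeta function `ζ(s, z)` (used for `Re z > 0`), defined as the analytic continuation
in `s` to `ℂ \ {1}` of the series `∑ 1 / (k + z) ^ s`. -/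
noncomputable def hurwitzZetaFun (s z : ℂ) : ℂ :=
  if h : ∃ f : ℂ → ℂ, IsHurwitzContinuation z f then h.choose s else 0

/-- The analytic continuation is unique, so the value `ζ(s, z)` does not depend on a choice. -/
theorem hurwitzZetaFun_eq {z : ℂ} {f : ℂ → ℂ} (hf : IsHurwitzContinuation z f) {s : ℂ}
    (hs : s ≠ 1) : hurwitzZetaFun s z = f s := by
  have h : ∃ f : ℂ → ℂ, IsHurwitzContinuation z f := ⟨f, hf⟩
  have hg := h.choose_spec
  have e : hurwitzZetaFun s z = h.choose s := by simp only [hurwitzZetaFun, dif_pos h]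
  rw [e]
  have hpre : IsPreconnected ({1}ᶜ : Set ℂ) :=
    (isConnected_compl_singleton_of_one_lt_rank (by simp) (1 : ℂ)).isPreconnected
  refine (hg.1.analyticOnNhd isOpen_compl_singleton).eqOn_of_preconnected_of_eventuallyEq
    (hf.1.analyticOnNhd isOpen_compl_singleton) hpre (z₀ := 2) (by simp) ?_ hs
  have ho : {s : ℂ | 1 < s.re} ∈ 𝓝 (2 : ℂ) :=
    (isOpen_lt continuous_const Complex.continuous_re).mem_nhds (by simp)
  filter_upwards [ho] with t ht
  exact (hg.2 t ht).unique (hf.2 t ht)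

/-- The partial sum of order `r` of the expansion of `ζ'(-l, z)`, where `l` is a natural number.
The number `bernoulli (2 * j)` is `B_{2j}`, `Nat.stirlingFirst n k` is the Stirling cycle number,
and `(ascPochhammer ℂ n).eval x` is the Pochhammer symbol `x (x + 1) ⋯ (x + n - 1)`. -/
noncomputable def hurwitzDerivExpansion (l r : ℕ) (z : ℂ) : ℂ :=
  z ^ (l + 1) / ((l : ℂ) + 1) * Complex.log z
    - z ^ l / 2 * Complex.log z
    - z ^ (l + 1) / ((l : ℂ) + 1) ^ 2
    + ∑ j ∈ Finset.Icc 1 r,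
        z ^ (-2 * (j : ℤ) + (l : ℤ) + 1) / ((2 * j).factorial : ℂ) * ((bernoulli (2 * j) : ℚ) : ℂ) *
          ∑ k ∈ Finset.range (2 * j),
            ((k : ℂ) + 1) * (Nat.stirlingFirst (2 * j - 1) (k + 1) : ℂ) * (-(l : ℂ)) ^ k
    - Complex.log z * ∑ j ∈ Finset.Icc 1 r,
        z ^ (-2 * (j : ℤ) + (l : ℤ) + 1) * ((bernoulli (2 * j) : ℚ) : ℂ) *
          (ascPochhammer ℂ (2 * j - 1)).eval (-(l : ℂ)) / ((2 * j).factorial : ℂ)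

/-! Let E_N(s, w) be the Euler–Maclaurin expansion `hurwitzPartialExpansion`. Its one-step defect
w^(-s) - E_N(s, w) + E_N(s, w + 1) is a Bernoulli integral (`hurwitzStepRemainder_eq`), of size
|w|^(-(Re s + 2N + 1)). The defects at w = k + z telescope, so ζ(s, z) = E_N(s, z) + T_N(s, z) for
Re s > 1, where the tail T_N is their sum. The right side is holomorphic for Re s + 2N > 1, s ≠ 1,
and independent of N there, so these formulas glue to the continuation.

At s = -l, differentiating E_N gives `hurwitzDerivExpansion`; the Stirling numbers enter as
coefficients of the Pochhammer polynomial. The derivative of the tail is controlled by Cauchy's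
estimate (`isBigO_deriv_hurwitzTail`). To leave room for that estimate the order is N = r + l + 2,
and the terms r ≤ j < N are bounded separately. They carry log z only through (-l)_{2j+1}, which
vanishes when l ≤ 2r; hence the two cases. -/

/-- The finite part of the Euler–Maclaurin expansion of `∑ (k + w) ^ (-s)`. -/
noncomputable def hurwitzPartialExpansion (N : ℕ) (s w : ℂ) : ℂ :=
  w ^ (1 - s) / (s - 1) + w ^ (-s) / 2 +
    ∑ j ∈ Finset.range N, ((bernoulli (2 * j + 2) : ℚ) : ℂ) / ((2 * j + 2).factorial : ℂ) *
      (ascPochhammer ℂ (2 * j + 1)).eval s * w ^ (-s - (2 * j + 1 : ℕ))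

/-- The defect of the Euler–Maclaurin expansion over one unit step. -/
noncomputable def hurwitzStepRemainder (N : ℕ) (s w : ℂ) : ℂ :=
  w ^ (-s) - hurwitzPartialExpansion N s w + hurwitzPartialExpansion N s (w + 1)

/-- The integral remainder of order `m` of the Euler–Maclaurin formula on `[w, w + 1]`. -/
noncomputable def bernoulliIntegral (m : ℕ) (s w : ℂ) : ℂ :=
  (ascPochhammer ℂ m).eval s / (m.factorial : ℂ) *
    ∫ x in (0 : ℝ)..1, (bernoulliFun m x : ℂ) * (w + x) ^ (-s - m)

/-! ### Euler–Maclaurin on a unit interval -/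

lemma add_ofReal_mem_slitPlane {w : ℂ} (hw : 0 < w.re) {x : ℝ} (hx : 0 ≤ x) :
    w + x ∈ Complex.slitPlane := by
  refine Complex.mem_slitPlane_iff.mpr (Or.inl ?_)
  simp only [Complex.add_re, Complex.ofReal_re]; linarith

lemma hasDerivAt_add_ofReal_cpow {w : ℂ} (hw : 0 < w.re) (a : ℂ) {x : ℝ} (hx : 0 ≤ x) :
    HasDerivAt (fun y : ℝ => (w + y) ^ a) (a * (w + x) ^ (a - 1)) x := by
  have h1 : HasDerivAt (fun y : ℂ => (w + y) ^ a) (a * (w + x) ^ (a - 1) * 1) (x : ℂ) :=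
    ((hasDerivAt_id (x : ℂ)).const_add w).cpow_const (add_ofReal_mem_slitPlane hw hx)
  simpa using h1.comp_ofReal

lemma continuousOn_add_ofReal_cpow {w : ℂ} (hw : 0 < w.re) (a : ℂ) :
    ContinuousOn (fun y : ℝ => (w + y) ^ a) (Set.uIcc 0 1) := fun x hx => by
  rw [Set.uIcc_of_le zero_le_one] at hx
  exact (hasDerivAt_add_ofReal_cpow hw a hx.1).continuousAt.continuousWithinAt

/-- Integration by parts, using B_{m+1}' = (m+1) B_m; differentiating the power supplies the factor
s + m that extends the Pochhammer symbol. -/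
lemma bernoulliIntegral_sub_succ {w : ℂ} (hw : 0 < w.re) (m : ℕ) (s : ℂ) :
    bernoulliIntegral m s w - bernoulliIntegral (m + 1) s w =
      (ascPochhammer ℂ m).eval s / ((m + 1).factorial : ℂ) *
        ((bernoulliFun (m + 1) 1 : ℂ) * (w + 1) ^ (-s - m) -
          (bernoulliFun (m + 1) 0 : ℂ) * w ^ (-s - m)) := by
  have hd : ∀ x ∈ Set.uIcc (0 : ℝ) 1, HasDerivAt
      (fun y : ℝ => (bernoulliFun (m + 1) y : ℂ) * (w + y) ^ (-s - m))
      ((m + 1) * ((bernoulliFun m x : ℂ) * (w + x) ^ (-s - m)) -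
        (s + m) * ((bernoulliFun (m + 1) x : ℂ) * (w + x) ^ (-s - (m + 1 : ℕ)))) x := by
    intro x hx
    rw [Set.uIcc_of_le zero_le_one] at hx
    have h1 := (hasDerivAt_bernoulliFun (m + 1) x).ofReal_comp
    have h2 := h1.mul (hasDerivAt_add_ofReal_cpow hw (-s - m) hx.1)
    refine h2.congr_deriv ?_
    have : -s - (m : ℂ) - 1 = -s - ((m + 1 : ℕ) : ℂ) := by push_cast; ring
    rw [this]
    simp only [Nat.add_sub_cancel]
    push_cast
    ring
  have hb : ∀ k : ℕ, Continuous fun x : ℝ => (bernoulliFun k x : ℂ) := fun k =>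
    Complex.continuous_ofReal.comp (continuous_bernoulliFun k)
  have hi : ∀ (k : ℕ) (a : ℂ), IntervalIntegrable
      (fun x : ℝ => (bernoulliFun k x : ℂ) * (w + x) ^ a) MeasureTheory.volume 0 1 := fun k a =>
    ((hb k).continuousOn.mul (continuousOn_add_ofReal_cpow hw a)).intervalIntegrable
  have key := intervalIntegral.integral_eq_sub_of_hasDerivAt hd
    (((hi m _).const_mul _).sub ((hi (m + 1) _).const_mul _))
  rw [intervalIntegral.integral_sub ((hi m _).const_mul _) ((hi (m + 1) _).const_mul _),
    intervalIntegral.integral_const_mul, intervalIntegral.integral_const_mul] at key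
  simp only [Complex.ofReal_one, Complex.ofReal_zero, add_zero] at key
  rw [← key]
  unfold bernoulliIntegral
  rw [ascPochhammer_succ_eval, Nat.factorial_succ]
  have h1 : (m.factorial : ℂ) ≠ 0 := by exact_mod_cast m.factorial_ne_zero
  have h2 : (m : ℂ) + 1 ≠ 0 := by exact_mod_cast m.succ_ne_zero
  push_cast
  field_simp

lemma bernoulliIntegral_zero {w : ℂ} (hw : 0 < w.re) {s : ℂ} (hs : s ≠ 1) :
    bernoulliIntegral 0 s w = (w ^ (1 - s) - (w + 1) ^ (1 - s)) / (s - 1) := by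
  have hs' : 1 - s ≠ 0 := sub_ne_zero.mpr hs.symm
  have hs'' : s - 1 ≠ 0 := sub_ne_zero.mpr hs
  have hd : ∀ x ∈ Set.uIcc (0 : ℝ) 1, HasDerivAt (fun y : ℝ => (w + y) ^ (1 - s) / (1 - s))
      ((w + x) ^ (-s)) x := by
    intro x hx
    rw [Set.uIcc_of_le zero_le_one] at hx
    refine ((hasDerivAt_add_ofReal_cpow hw (1 - s) hx.1).div_const _).congr_deriv ?_
    rw [show 1 - s - 1 = -s by ring]
    field_simp
  have key := intervalIntegral.integral_eq_sub_of_hasDerivAt hd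
    (continuousOn_add_ofReal_cpow hw _).intervalIntegrable
  simp only [bernoulliIntegral, ascPochhammer_zero, Polynomial.eval_one, Nat.factorial_zero,
    Nat.cast_one, bernoulliFun_zero, Complex.ofReal_one, one_mul, Nat.cast_zero, sub_zero, div_one]
  rw [key]
  simp only [Complex.ofReal_one, Complex.ofReal_zero, add_zero]
  field_simp
  ring

/-- The Euler–Maclaurin formula on a unit interval. -/
lemma hurwitzStepRemainder_eq {w : ℂ} (hw : 0 < w.re) {s : ℂ} (hs : s ≠ 1) (N : ℕ) :
    hurwitzStepRemainder N s w = -bernoulliIntegral (2 * N + 1) s w := by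
  induction N with
  | zero =>
    -- The endpoint values B_1(0) = -1/2 and B_1(1) = 1/2 produce the half terms w^(-s)/2.
    have h := bernoulliIntegral_sub_succ hw 0 s
    rw [bernoulliIntegral_zero hw hs] at h
    simp only [hurwitzStepRemainder, hurwitzPartialExpansion, Finset.range_zero, Finset.sum_empty]
    simp only [zero_add, bernoulliFun_one, ascPochhammer_zero, Polynomial.eval_one,
      Nat.cast_zero, sub_zero] at h
    norm_num at h
    norm_num
    linear_combination -h
  | succ N ih =>
    have h1 := bernoulliIntegral_sub_succ hw (2 * N + 1) s
    have h2 := bernoulliIntegral_sub_succ hw (2 * N + 2) s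
    rw [bernoulliFun_endpoints_eq_of_ne_one (by omega), bernoulliFun_eval_zero] at h1 h2
    -- B_{2N+3} = 0, so two integrations by parts add just the one term with B_{2N+2}.
    rw [bernoulli_eq_zero_of_odd ⟨N + 1, by ring⟩ (by omega)] at h2
    simp only [Rat.cast_zero, Complex.ofReal_zero, zero_mul, sub_zero, mul_zero] at h2
    rw [Complex.ofReal_ratCast] at h1
    rw [show 2 * (N + 1) + 1 = 2 * N + 2 + 1 by ring]
    simp only [hurwitzStepRemainder, hurwitzPartialExpansion, Finset.sum_range_succ] at ih ⊢
    linear_combination ih - h1 - h2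

/-! ### Uniform bounds and the tail series -/

lemma norm_cpow_neg_le {w : ℂ} (hw : w ≠ 0) (a : ℂ) :
    ‖w ^ (-a)‖ ≤ Real.exp (Real.pi * |a.im|) * ‖w‖ ^ (-a.re) := by
  rw [Complex.norm_cpow_of_ne_zero hw, Complex.neg_re, Complex.neg_im, mul_comm (Real.exp _),
    div_eq_mul_inv, ← Real.exp_neg]
  gcongr
  have h1 := Complex.abs_arg_le_pi w
  calc -(w.arg * -a.im) = w.arg * a.im := by ring
    _ ≤ |w.arg * a.im| := le_abs_self _
    _ = |w.arg| * |a.im| := abs_mul _ _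
    _ ≤ _ := by gcongr

lemma norm_le_norm_add_ofReal {w : ℂ} (hw : 0 < w.re) {x : ℝ} (hx : 0 ≤ x) :
    ‖w‖ ≤ ‖w + x‖ := by
  rw [← sq_le_sq₀ (norm_nonneg _) (norm_nonneg _), Complex.sq_norm, Complex.sq_norm,
    Complex.normSq_apply, Complex.normSq_apply]
  simp only [Complex.add_re, Complex.ofReal_re, Complex.add_im, Complex.ofReal_im]
  nlinarith [mul_nonneg hw.le hx]

lemma sq_add_sq_le_norm_natCast_add {z : ℂ} (hz : 0 < z.re) (k : ℕ) :
    (k : ℝ) ^ 2 + ‖z‖ ^ 2 ≤ ‖(k : ℂ) + z‖ ^ 2 := by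
  rw [Complex.sq_norm, Complex.sq_norm, Complex.normSq_apply, Complex.normSq_apply]
  simp only [Complex.add_re, Complex.natCast_re, Complex.add_im, Complex.natCast_im]
  nlinarith [mul_nonneg hz.le (Nat.cast_nonneg (α := ℝ) k)]

lemma ne_zero_of_re_pos {w : ℂ} (hw : 0 < w.re) : w ≠ 0 := by
  rintro rfl; simp at hw

lemma natCast_add_re_pos {z : ℂ} (hz : 0 < z.re) (k : ℕ) : 0 < ((k : ℂ) + z).re := by
  simp only [Complex.add_re, Complex.natCast_re]; positivity

lemma exists_norm_bernoulliIntegral_le (m : ℕ) (R : ℝ) :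
    ∃ C : ℝ, 0 ≤ C ∧ ∀ s w : ℂ, ‖s‖ ≤ R → 0 ≤ s.re + m → 0 < w.re →
      ‖bernoulliIntegral m s w‖ ≤ C * ‖w‖ ^ (-(s.re + m)) := by
  obtain ⟨A, hA⟩ := (isCompact_closedBall (0 : ℂ) R).exists_bound_of_continuousOn
    (f := fun s : ℂ => (ascPochhammer ℂ m).eval s / (m.factorial : ℂ))
    ((Polynomial.continuous _).div_const _).continuousOn
  obtain ⟨B, hB⟩ := (isCompact_Icc (a := (0 : ℝ)) (b := 1)).exists_bound_of_continuousOn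
    (continuous_bernoulliFun m).continuousOn
  have hB0 : 0 ≤ B := (norm_nonneg _).trans (hB 0 (by simp))
  refine ⟨|A| * (B * Real.exp (Real.pi * |R|)), by positivity, fun s w hs hsm hw => ?_⟩
  have hwp : 0 < ‖w‖ := norm_pos_iff.mpr (ne_zero_of_re_pos hw)
  have hint : ‖∫ x in (0 : ℝ)..1, (bernoulliFun m x : ℂ) * (w + x) ^ (-s - m)‖ ≤
      B * Real.exp (Real.pi * |R|) * ‖w‖ ^ (-(s.re + m)) * |1 - 0| := by
    refine intervalIntegral.norm_integral_le_of_norm_le_const fun x hx => ?_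
    rw [Set.uIoc_of_le zero_le_one] at hx
    have hne : w + x ≠ 0 := Complex.slitPlane_ne_zero (add_ofReal_mem_slitPlane hw hx.1.le)
    rw [norm_mul, Complex.norm_real, mul_assoc B]
    refine mul_le_mul (hB x ⟨hx.1.le, hx.2⟩) ?_ (norm_nonneg _) hB0
    rw [show -s - (m : ℂ) = -(s + m) by ring]
    refine (norm_cpow_neg_le hne _).trans ?_
    simp only [Complex.add_im, Complex.natCast_im, add_zero, Complex.add_re, Complex.natCast_re]
    refine mul_le_mul ?_ ?_ (by positivity) (by positivity)
    · exact Real.exp_le_exp.mpr (mul_le_mul_of_nonneg_left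
        ((Complex.abs_im_le_norm s).trans (hs.trans (le_abs_self R))) Real.pi_pos.le)
    · exact Real.rpow_le_rpow_of_nonpos hwp (norm_le_norm_add_ofReal hw hx.1.le) (by linarith)
  rw [bernoulliIntegral, norm_mul, mul_assoc]
  refine mul_le_mul ((hA s (by simpa using hs)).trans (le_abs_self A)) ?_ (norm_nonneg _)
    (abs_nonneg _)
  simpa using hint

lemma exists_norm_hurwitzStepRemainder_le (N : ℕ) (R : ℝ) :
    ∃ C : ℝ, 0 ≤ C ∧ ∀ s z : ℂ, ‖s‖ ≤ R → s ≠ 1 → 1 ≤ s.re + 2 * N → 0 < z.re → 1 ≤ ‖z‖ →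
      ∀ k : ℕ, ‖hurwitzStepRemainder N s (k + z)‖ ≤
        C * ‖z‖ ^ (-(s.re + 2 * N - 1)) * (1 / ((k : ℝ) ^ 2 + 1)) := by
  obtain ⟨C, hC0, hC⟩ := exists_norm_bernoulliIntegral_le (2 * N + 1) R
  refine ⟨C, hC0, fun s z hs hs1 hsN hz hz1 k => ?_⟩
  have hw := natCast_add_re_pos hz k
  rw [hurwitzStepRemainder_eq hw hs1, norm_neg]
  refine (hC s _ hs (by push_cast; linarith) hw).trans ?_
  rw [mul_assoc]
  refine mul_le_mul_of_nonneg_left ?_ hC0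
  have hsq := sq_add_sq_le_norm_natCast_add hz k
  have hwp : 0 < ‖(k : ℂ) + z‖ := norm_pos_iff.mpr (ne_zero_of_re_pos hw)
  have hzw : ‖z‖ ≤ ‖(k : ℂ) + z‖ := by
    rw [← sq_le_sq₀ (norm_nonneg _) (norm_nonneg _)]
    nlinarith [sq_nonneg (k : ℝ)]
  -- Two powers of |k + z| pay for summability in k; the others, with nonpositive exponent, are
  -- bounded by powers of |z|.
  rw [show -(s.re + ((2 * N + 1 : ℕ) : ℝ)) = -(s.re + 2 * N - 1) + -(2 : ℕ) by push_cast; ring,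
    Real.rpow_add hwp]
  refine mul_le_mul ?_ ?_ (by positivity) (by positivity)
  · exact Real.rpow_le_rpow_of_nonpos (by linarith) hzw (by linarith)
  · rw [Real.rpow_neg hwp.le, Real.rpow_natCast, ← one_div]
    refine one_div_le_one_div_of_le (by positivity) ?_
    nlinarith

lemma summable_one_div_sq_add_one : Summable fun k : ℕ => 1 / ((k : ℝ) ^ 2 + 1) := by
  refine Summable.of_norm_bounded_eventually_nat
    (Real.summable_one_div_nat_pow.mpr (le_refl 2)) ?_
  filter_upwards [eventually_gt_atTop 0] with k hk
  rw [Real.norm_of_nonneg (by positivity)]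
  have : (0 : ℝ) < k := by exact_mod_cast hk
  exact one_div_le_one_div_of_le (by positivity) (by linarith)

/-- The tail series correcting the partial expansion to the Hurwitz zeta function. -/
noncomputable def hurwitzTail (N : ℕ) (s z : ℂ) : ℂ := ∑' k : ℕ, hurwitzStepRemainder N s (k + z)

lemma summable_hurwitzStepRemainder {N : ℕ} {s z : ℂ} (hs : s ≠ 1) (hsN : 1 ≤ s.re + 2 * N)
    (hz : 0 < z.re) (hz1 : 1 ≤ ‖z‖) :
    Summable fun k : ℕ => hurwitzStepRemainder N s (k + z) := by
  obtain ⟨C, -, hC⟩ := exists_norm_hurwitzStepRemainder_le N ‖s‖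
  exact Summable.of_norm_bounded (summable_one_div_sq_add_one.mul_left _)
    (hC s z le_rfl hs hsN hz hz1)

lemma exists_norm_hurwitzTail_le (N : ℕ) (R : ℝ) :
    ∃ C : ℝ, 0 ≤ C ∧ ∀ s z : ℂ, ‖s‖ ≤ R → s ≠ 1 → 1 ≤ s.re + 2 * N → 0 < z.re → 1 ≤ ‖z‖ →
      ‖hurwitzTail N s z‖ ≤ C * ‖z‖ ^ (-(s.re + 2 * N - 1)) := by
  obtain ⟨C, hC0, hC⟩ := exists_norm_hurwitzStepRemainder_le N R
  refine ⟨C * ∑' k : ℕ, 1 / ((k : ℝ) ^ 2 + 1), mul_nonneg hC0 (tsum_nonneg fun k => by positivity),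
    fun s z hs hs1 hsN hz hz1 => ?_⟩
  refine (tsum_of_norm_bounded (summable_one_div_sq_add_one.hasSum.mul_left _)
    (hC s z hs hs1 hsN hz hz1)).trans (le_of_eq (by ring))

/-! ### Holomorphy in s and independence of the order -/

lemma differentiableAt_cpow_affine {w : ℂ} (hw : w ≠ 0) {a : ℂ → ℂ} {s : ℂ}
    (ha : DifferentiableAt ℂ a s) : DifferentiableAt ℂ (fun t => w ^ a t) s :=
  ha.const_cpow (Or.inl hw)

lemma differentiableAt_hurwitzPartialExpansion (N : ℕ) {s w : ℂ} (hw : w ≠ 0) (hs : s ≠ 1) :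
    DifferentiableAt ℂ (fun t => hurwitzPartialExpansion N t w) s := by
  have h (a : ℂ → ℂ) (ha : DifferentiableAt ℂ a s) := differentiableAt_cpow_affine hw ha
  unfold hurwitzPartialExpansion
  refine DifferentiableAt.add (DifferentiableAt.add ?_ ?_) ?_
  · exact (h _ (by fun_prop)).div (by fun_prop) (sub_ne_zero.mpr hs)
  · exact (h _ (by fun_prop)).div_const _
  · refine DifferentiableAt.fun_sum fun j _ => ?_
    exact (Polynomial.differentiableAt _).const_mul _ |>.mul (h _ (by fun_prop))

lemma differentiableAt_hurwitzStepRemainder (N : ℕ) {s w : ℂ} (hw : 0 < w.re) (hs : s ≠ 1) :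
    DifferentiableAt ℂ (fun t => hurwitzStepRemainder N t w) s := by
  have hw1 : 0 < (w + 1).re := by simp only [Complex.add_re, Complex.one_re]; linarith
  unfold hurwitzStepRemainder
  refine DifferentiableAt.add (DifferentiableAt.sub ?_ ?_) ?_
  · exact differentiableAt_cpow_affine (ne_zero_of_re_pos hw) (by fun_prop)
  · exact differentiableAt_hurwitzPartialExpansion N (ne_zero_of_re_pos hw) hs
  · exact differentiableAt_hurwitzPartialExpansion N (ne_zero_of_re_pos hw1) hs

lemma differentiableAt_hurwitzTail {N : ℕ} {s z : ℂ} (hs : s ≠ 1) (hsN : 1 < s.re + 2 * N)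
    (hz : 0 < z.re) (hz1 : 1 ≤ ‖z‖) : DifferentiableAt ℂ (fun t => hurwitzTail N t z) s := by
  obtain ⟨C, hC0, hC⟩ := exists_norm_hurwitzStepRemainder_le N (‖s‖ + 1)
  -- On this neighbourhood the remainder bound is uniform in t, so the Weierstrass M-test applies.
  let U : Set ℂ := {t | t ≠ 1} ∩ {t | 1 < t.re + 2 * N} ∩ {t | ‖t‖ < ‖s‖ + 1}
  have hU : IsOpen U := (isOpen_ne.inter (isOpen_lt (by fun_prop) (by fun_prop))).inter
    (isOpen_lt (by fun_prop) (by fun_prop))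
  have hsU : s ∈ U := ⟨⟨hs, hsN⟩, by simp⟩
  refine (Complex.differentiableOn_tsum_of_summable_norm
    (F := fun (k : ℕ) t => hurwitzStepRemainder N t (k + z))
    (summable_one_div_sq_add_one.mul_left C) (fun k t ht => ?_) hU
    fun k t ht => ?_).differentiableAt (hU.mem_nhds hsU)
  · exact (differentiableAt_hurwitzStepRemainder N (natCast_add_re_pos hz k)
      ht.1.1).differentiableWithinAt
  · have h1 : 1 < t.re + 2 * N := ht.1.2
    have h2 : ‖t‖ < ‖s‖ + 1 := ht.2
    refine (hC t z h2.le ht.1.1 h1.le hz hz1 k).trans ?_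
    gcongr
    refine mul_le_of_le_one_right hC0 (Real.rpow_le_one_of_one_le_of_nonpos hz1 ?_)
    linarith

lemma sum_range_hurwitzStepRemainder (N : ℕ) (s z : ℂ) (K : ℕ) :
    ∑ k ∈ Finset.range K, hurwitzStepRemainder N s (k + z) =
      ∑ k ∈ Finset.range K, ((k : ℂ) + z) ^ (-s) - hurwitzPartialExpansion N s z +
        hurwitzPartialExpansion N s (K + z) := by
  induction K with
  | zero => simp
  | succ K ih =>
    rw [Finset.sum_range_succ, Finset.sum_range_succ, ih, hurwitzStepRemainder,
      show ((K + 1 : ℕ) : ℂ) + z = K + z + 1 by push_cast; ring]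
    ring

lemma tendsto_sum_add_hurwitzPartialExpansion {N : ℕ} {s z : ℂ} (hs : s ≠ 1)
    (hsN : 1 ≤ s.re + 2 * N) (hz : 0 < z.re) (hz1 : 1 ≤ ‖z‖) :
    Tendsto (fun K : ℕ => ∑ k ∈ Finset.range K, ((k : ℂ) + z) ^ (-s) +
      hurwitzPartialExpansion N s (K + z)) atTop
      (𝓝 (hurwitzPartialExpansion N s z + hurwitzTail N s z)) := by
  have h := ((summable_hurwitzStepRemainder hs hsN hz hz1).hasSum.tendsto_sum_nat).const_add
    (hurwitzPartialExpansion N s z)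
  refine h.congr fun K => ?_
  rw [sum_range_hurwitzStepRemainder]; ring

lemma tendsto_natCast_add_cpow_neg {z a : ℂ} (hz : 0 < z.re) (ha : 0 < a.re) :
    Tendsto (fun K : ℕ => ((K : ℂ) + z) ^ (-a)) atTop (𝓝 0) := by
  have h1 : Tendsto (fun K : ℕ => Real.exp (Real.pi * |a.im|) * (K : ℝ) ^ (-a.re)) atTop (𝓝 0) := by
    simpa using ((tendsto_rpow_neg_atTop ha).comp tendsto_natCast_atTop_atTop).const_mul
      (Real.exp (Real.pi * |a.im|))
  refine squeeze_zero_norm' ?_ h1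
  filter_upwards [eventually_gt_atTop 0] with K hK
  refine (norm_cpow_neg_le (ne_zero_of_re_pos (natCast_add_re_pos hz K)) a).trans ?_
  refine mul_le_mul_of_nonneg_left ?_ (Real.exp_pos _).le
  refine Real.rpow_le_rpow_of_nonpos (by exact_mod_cast hK) ?_ (by linarith)
  refine le_trans ?_ (Complex.re_le_norm _)
  simp only [Complex.add_re, Complex.natCast_re]; linarith

/-- Both sides are limits in K of sequences differing by a multiple of (K + z)^(-(s + 2N + 1)),
which tends to 0. -/
lemma hurwitz_partial_add_tail_succ {N : ℕ} {s z : ℂ} (hs : s ≠ 1)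
    (hsN : 1 ≤ s.re + 2 * N) (hz : 0 < z.re) (hz1 : 1 ≤ ‖z‖) :
    hurwitzPartialExpansion (N + 1) s z + hurwitzTail (N + 1) s z =
      hurwitzPartialExpansion N s z + hurwitzTail N s z := by
  refine tendsto_nhds_unique
    (tendsto_sum_add_hurwitzPartialExpansion hs (by push_cast; linarith) hz hz1) ?_
  have h0 : Tendsto (fun K : ℕ => ((K : ℂ) + z) ^ (-(s + (2 * N + 1 : ℕ)))) atTop (𝓝 0) :=
    tendsto_natCast_add_cpow_neg hz (by
      simp only [Complex.add_re, Complex.natCast_re]; push_cast; linarith)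
  have h1 := (tendsto_sum_add_hurwitzPartialExpansion hs hsN hz hz1).add
    (h0.const_mul (((bernoulli (2 * N + 2) : ℚ) : ℂ) / ((2 * N + 2).factorial : ℂ) *
      (ascPochhammer ℂ (2 * N + 1)).eval s))
  rw [mul_zero, add_zero] at h1
  refine h1.congr fun K => ?_
  rw [hurwitzPartialExpansion, hurwitzPartialExpansion, Finset.sum_range_succ, neg_add']
  ring

lemma hurwitz_partial_add_tail_of_le {N N' : ℕ} (hN : N ≤ N') {s z : ℂ} (hs : s ≠ 1)
    (hsN : 1 ≤ s.re + 2 * N) (hz : 0 < z.re) (hz1 : 1 ≤ ‖z‖) :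
    hurwitzPartialExpansion N' s z + hurwitzTail N' s z =
      hurwitzPartialExpansion N s z + hurwitzTail N s z := by
  induction N', hN using Nat.le_induction with
  | base => rfl
  | succ n hn ih =>
    rw [← ih]
    refine hurwitz_partial_add_tail_succ hs ?_ hz hz1
    have : (N : ℝ) ≤ n := by exact_mod_cast hn
    linarith

/-! ### Gluing to the analytic continuation -/

/-- The analytic continuation of the Hurwitz zeta function, glued from Euler–Maclaurin formulas. -/
noncomputable def hurwitzContinuation (z s : ℂ) : ℂ :=
  hurwitzPartialExpansion (⌈‖s‖⌉₊ + 1) s z + hurwitzTail (⌈‖s‖⌉₊ + 1) s z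

lemma one_lt_re_add {s : ℂ} : 1 < s.re + 2 * ((⌈‖s‖⌉₊ + 1 : ℕ) : ℝ) := by
  have h1 := Nat.le_ceil ‖s‖
  have h2 := (abs_le.mp (Complex.abs_re_le_norm s)).1
  have h3 := norm_nonneg s
  push_cast
  linarith

lemma hurwitzContinuation_eq {N : ℕ} {s z : ℂ} (hs : s ≠ 1) (hsN : 1 ≤ s.re + 2 * N)
    (hz : 0 < z.re) (hz1 : 1 ≤ ‖z‖) :
    hurwitzContinuation z s = hurwitzPartialExpansion N s z + hurwitzTail N s z := by
  rcases le_total N (⌈‖s‖⌉₊ + 1) with h | h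
  · exact hurwitz_partial_add_tail_of_le h hs hsN hz hz1
  · exact (hurwitz_partial_add_tail_of_le h hs one_lt_re_add.le hz hz1).symm

/-- The order in the definition jumps with s; a fixed order near s is what allows differentiation.
-/
lemma hurwitzContinuation_eventuallyEq {N : ℕ} {s z : ℂ} (hs : s ≠ 1) (hsN : 1 < s.re + 2 * N)
    (hz : 0 < z.re) (hz1 : 1 ≤ ‖z‖) :
    hurwitzContinuation z =ᶠ[𝓝 s]
      fun t => hurwitzPartialExpansion N t z + hurwitzTail N t z := by
  have ho : IsOpen {t : ℂ | 1 < t.re + 2 * N} := isOpen_lt (by fun_prop) (by fun_prop)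
  filter_upwards [isOpen_ne.mem_nhds hs, ho.mem_nhds hsN] with t ht htN
  exact hurwitzContinuation_eq ht (le_of_lt htN) hz hz1

lemma summable_natCast_add_cpow_neg {s z : ℂ} (hs : 1 < s.re) (hz : 0 < z.re) :
    Summable fun k : ℕ => ((k : ℂ) + z) ^ (-s) := by
  refine Summable.of_norm_bounded_eventually_nat
    (g := fun k : ℕ => Real.exp (Real.pi * |s.im|) * (k : ℝ) ^ (-s.re))
    ((Real.summable_nat_rpow.mpr (by linarith)).mul_left _) ?_
  filter_upwards [eventually_gt_atTop 0] with K hK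
  refine (norm_cpow_neg_le (ne_zero_of_re_pos (natCast_add_re_pos hz K)) s).trans ?_
  refine mul_le_mul_of_nonneg_left ?_ (Real.exp_pos _).le
  refine Real.rpow_le_rpow_of_nonpos (by exact_mod_cast hK) ?_ (by linarith)
  refine le_trans ?_ (Complex.re_le_norm _)
  simp only [Complex.add_re, Complex.natCast_re]; linarith

lemma isHurwitzContinuation_hurwitzContinuation {z : ℂ} (hz : 0 < z.re) (hz1 : 1 ≤ ‖z‖) :
    IsHurwitzContinuation z (hurwitzContinuation z) := by
  refine ⟨fun s hs => ?_, fun s hs => ?_⟩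
  · have hs' : s ≠ 1 := hs
    refine DifferentiableAt.differentiableWithinAt ?_
    exact ((differentiableAt_hurwitzPartialExpansion _ (ne_zero_of_re_pos hz) hs').add
      (differentiableAt_hurwitzTail hs' one_lt_re_add hz hz1)).congr_of_eventuallyEq
      (hurwitzContinuation_eventuallyEq hs' one_lt_re_add hz hz1)
  · have hs1 : s ≠ 1 := by rintro rfl; simp at hs
    have hsum := summable_natCast_add_cpow_neg hs hz
    -- For Re s > 1 order 0 suffices, and its boundary term vanishes at infinity, leaving the series
    -- itself.
    have h0 : Tendsto (fun K : ℕ => hurwitzPartialExpansion 0 s (K + z)) atTop (𝓝 0) := by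
      have h1 := (tendsto_natCast_add_cpow_neg hz (a := s - 1)
        (by simpa using hs)).div_const (s - 1)
      have h2 := (tendsto_natCast_add_cpow_neg hz (a := s) (by linarith)).div_const 2
      simpa [hurwitzPartialExpansion] using h1.add h2
    have h1 := tendsto_sum_add_hurwitzPartialExpansion (N := 0) hs1
      (by simpa using hs.le) hz hz1
    have h2 := hsum.hasSum.tendsto_sum_nat.add h0
    have h3 := tendsto_nhds_unique h1 h2
    rw [hurwitzContinuation_eq (N := 0) hs1 (by simpa using hs.le) hz hz1, h3, add_zero]
    simpa only [one_div, ← Complex.cpow_neg] using hsum.hasSum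

/-! ### Differentiating the expansion at s = -l -/

lemma coeff_ascPochhammer (n k : ℕ) :
    (ascPochhammer ℂ n).coeff k = (Nat.stirlingFirst n k : ℂ) := by
  induction n generalizing k with
  | zero => cases k <;> simp [Polynomial.coeff_one]
  | succ n ih =>
    rw [ascPochhammer_succ_right, mul_add, Polynomial.coeff_add, ← Polynomial.C_eq_natCast,
      Polynomial.coeff_mul_C]
    cases k with
    | zero => cases n <;> simp [ih]
    | succ k =>
      rw [Polynomial.coeff_mul_X, ih, ih, Nat.stirlingFirst_succ_succ]
      push_cast; ring

lemma eval_derivative_ascPochhammer (n : ℕ) (x : ℂ) :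
    (Polynomial.derivative (ascPochhammer ℂ n)).eval x =
      ∑ k ∈ Finset.range (n + 1), ((k : ℂ) + 1) * (Nat.stirlingFirst n (k + 1) : ℂ) * x ^ k := by
  have hdeg : (Polynomial.derivative (ascPochhammer ℂ n)).natDegree < n + 1 := by
    refine (Polynomial.natDegree_derivative_le _).trans_lt ?_
    rw [ascPochhammer_natDegree]; omega
  rw [Polynomial.eval_eq_sum_range' hdeg]
  refine Finset.sum_congr rfl fun k _ => ?_
  rw [Polynomial.coeff_derivative, coeff_ascPochhammer]; ring

/-- The `j`-th correction term (counted from zero) of the expansion of `ζ'(-l, z)`. -/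
noncomputable def hurwitzDerivTerm (l j : ℕ) (z : ℂ) : ℂ :=
  ((bernoulli (2 * j + 2) : ℚ) : ℂ) / ((2 * j + 2).factorial : ℂ) *
    z ^ ((l : ℤ) - (2 * j + 1)) *
    ((Polynomial.derivative (ascPochhammer ℂ (2 * j + 1))).eval (-(l : ℂ)) -
      Complex.log z * (ascPochhammer ℂ (2 * j + 1)).eval (-(l : ℂ)))

lemma hurwitzDerivExpansion_eq (l r : ℕ) (z : ℂ) :
    hurwitzDerivExpansion l r z =
      z ^ (l + 1) / ((l : ℂ) + 1) * Complex.log z - z ^ l / 2 * Complex.log z -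
        z ^ (l + 1) / ((l : ℂ) + 1) ^ 2 + ∑ j ∈ Finset.range r, hurwitzDerivTerm l j z := by
  induction r with
  | zero => simp [hurwitzDerivExpansion]
  | succ r ih =>
    rw [hurwitzDerivExpansion] at ih
    rw [hurwitzDerivExpansion, Finset.sum_Icc_succ_top (by omega), Finset.sum_Icc_succ_top (by omega),
      Finset.sum_range_succ, hurwitzDerivTerm, eval_derivative_ascPochhammer,
      show -2 * ((r + 1 : ℕ) : ℤ) + (l : ℤ) + 1 = (l : ℤ) - (2 * r + 1) by push_cast; ring,
      show 2 * (r + 1) - 1 = 2 * r + 1 by omega, show 2 * (r + 1) = 2 * r + 1 + 1 by ring]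
    linear_combination ih

lemma hasDerivAt_const_cpow_comp {w : ℂ} (hw : w ≠ 0) {a : ℂ → ℂ} {s : ℂ}
    (ha : HasDerivAt a (-1) s) :
    HasDerivAt (fun t => w ^ a t) (-(w ^ a s * Complex.log w)) s :=
  (ha.const_cpow (Or.inl hw)).congr_deriv (by ring)

lemma hasDerivAt_hurwitzPartialExpansion (l N : ℕ) {z : ℂ} (hz : z ≠ 0) :
    HasDerivAt (fun t => hurwitzPartialExpansion N t z) (hurwitzDerivExpansion l N z) (-(l : ℂ)) := by
  have hl : (l : ℂ) + 1 ≠ 0 := by exact_mod_cast l.succ_ne_zero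
  have hl' : -(l : ℂ) - 1 ≠ 0 := by rw [← neg_add']; exact neg_ne_zero.mpr hl
  have h1 : HasDerivAt (fun t : ℂ => z ^ (1 - t) / (t - 1))
      (z ^ (l + 1) / ((l : ℂ) + 1) * Complex.log z - z ^ (l + 1) / ((l : ℂ) + 1) ^ 2) (-(l : ℂ)) := by
    refine ((hasDerivAt_const_cpow_comp hz ((hasDerivAt_id' (-(l : ℂ))).const_sub 1)).div
      ((hasDerivAt_id' (-(l : ℂ))).sub_const 1) hl').congr_deriv ?_
    rw [show (1 : ℂ) - -(l : ℂ) = ((l + 1 : ℕ) : ℂ) by push_cast; ring, Complex.cpow_natCast,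
      ← neg_add' (l : ℂ) 1]
    field_simp
  have h2 : HasDerivAt (fun t : ℂ => z ^ (-t) / 2) (-(z ^ l / 2 * Complex.log z)) (-(l : ℂ)) := by
    refine ((hasDerivAt_const_cpow_comp hz (hasDerivAt_neg _)).div_const 2).congr_deriv ?_
    rw [neg_neg, Complex.cpow_natCast]
    ring
  have h3 : ∀ j ∈ Finset.range N, HasDerivAt
      (fun t : ℂ => ((bernoulli (2 * j + 2) : ℚ) : ℂ) / ((2 * j + 2).factorial : ℂ) *
        (ascPochhammer ℂ (2 * j + 1)).eval t * z ^ (-t - (2 * j + 1 : ℕ)))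
      (hurwitzDerivTerm l j z) (-(l : ℂ)) := by
    intro j _
    refine (((Polynomial.hasDerivAt _ _).const_mul _).mul
      (hasDerivAt_const_cpow_comp hz ((hasDerivAt_neg _).sub_const _))).congr_deriv ?_
    rw [show - -(l : ℂ) - ((2 * j + 1 : ℕ) : ℂ) = (((l : ℤ) - (2 * j + 1) : ℤ) : ℂ) by
      push_cast; ring, Complex.cpow_intCast, hurwitzDerivTerm]
    ring
  refine ((h1.add h2).add (HasDerivAt.fun_sum h3)).congr_deriv ?_
  rw [hurwitzDerivExpansion_eq]
  ring

/-! ### Asymptotics as z tends to infinity -/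

lemma eventually_norm_ge_re_pos (R : ℝ) :
    ∀ᶠ z : ℂ in Bornology.cobounded ℂ ⊓ 𝓟 {z : ℂ | 0 < z.re}, R ≤ ‖z‖ ∧ 0 < z.re :=
  ((tendsto_norm_cobounded_atTop.eventually_ge_atTop R).filter_mono inf_le_left).and
    (mem_inf_of_right (mem_principal_self _))

lemma isBigO_zpow_of_le {a b : ℤ} (hab : a ≤ b) :
    (fun z : ℂ => z ^ a) =O[Bornology.cobounded ℂ ⊓ 𝓟 {z : ℂ | 0 < z.re}]
      fun z : ℂ => ‖z‖ ^ b := by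
  refine IsBigO.of_bound 1 ?_
  filter_upwards [eventually_norm_ge_re_pos 1] with z hz
  rw [norm_zpow, norm_zpow, norm_norm, one_mul]
  exact zpow_le_zpow_right₀ hz.1 hab

lemma one_le_log_of_exp_le {x : ℝ} (hx : Real.exp 1 ≤ x) : 1 ≤ Real.log x :=
  (Real.le_log_iff_exp_le ((Real.exp_pos 1).trans_le hx)).mpr hx

lemma isBigO_const_log_norm (c : ℂ) :
    (fun _ : ℂ => c) =O[Bornology.cobounded ℂ ⊓ 𝓟 {z : ℂ | 0 < z.re}]
      fun z : ℂ => Real.log ‖z‖ := by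
  refine IsBigO.of_bound ‖c‖ ?_
  filter_upwards [eventually_norm_ge_re_pos (Real.exp 1)] with z hz
  have h := one_le_log_of_exp_le hz.1
  rw [Real.norm_of_nonneg (by linarith)]
  nlinarith [norm_nonneg c]

lemma isBigO_log_log_norm :
    Complex.log =O[Bornology.cobounded ℂ ⊓ 𝓟 {z : ℂ | 0 < z.re}]
      fun z : ℂ => Real.log ‖z‖ := by
  refine IsBigO.of_bound (1 + Real.pi) ?_
  filter_upwards [eventually_norm_ge_re_pos (Real.exp 1)] with z hz
  have h := one_le_log_of_exp_le hz.1
  have h1 := Complex.norm_le_abs_re_add_abs_im (Complex.log z)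
  rw [Complex.log_re, Complex.log_im, abs_of_nonneg (by linarith)] at h1
  rw [Real.norm_of_nonneg (by linarith)]
  nlinarith [Complex.abs_arg_le_pi z, Real.pi_pos]

lemma isBigO_hurwitzDerivTerm_log {l r j : ℕ} (hj : r ≤ j) :
    hurwitzDerivTerm l j =O[Bornology.cobounded ℂ ⊓ 𝓟 {z : ℂ | 0 < z.re}]
      fun z : ℂ => ‖z‖ ^ (-(2 * (r : ℤ) - (l : ℤ) + 1)) * Real.log ‖z‖ := by
  refine IsBigO.mul ((isBigO_zpow_of_le (by omega)).const_mul_left _) ?_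
  refine (isBigO_const_log_norm _).sub ?_
  exact (isBigO_log_log_norm.const_mul_left _).congr_left fun z => mul_comm _ _

lemma isBigO_hurwitzDerivTerm {l r j : ℕ} (hj : r ≤ j) (hl : l ≤ 2 * r) :
    hurwitzDerivTerm l j =O[Bornology.cobounded ℂ ⊓ 𝓟 {z : ℂ | 0 < z.re}]
      fun z : ℂ => ‖z‖ ^ (-(2 * (r : ℤ) - (l : ℤ) + 1)) := by
  -- Since l ≤ 2r ≤ 2j, one factor of the Pochhammer product is zero, which removes log z.
  have h0 : (ascPochhammer ℂ (2 * j + 1)).eval (-(l : ℂ)) = 0 :=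
    ascPochhammer_eval_neg_coe_nat_of_lt (by omega)
  have h : hurwitzDerivTerm l j = fun z => (((bernoulli (2 * j + 2) : ℚ) : ℂ) /
      ((2 * j + 2).factorial : ℂ) *
      (Polynomial.derivative (ascPochhammer ℂ (2 * j + 1))).eval (-(l : ℂ))) *
      z ^ ((l : ℤ) - (2 * j + 1)) := by
    funext z
    rw [hurwitzDerivTerm, h0]
    ring
  rw [h]
  exact (isBigO_zpow_of_le (by omega)).const_mul_left _

/-- Cauchy's estimate on the disc of radius 1/2 about -l, which avoids 1. There Re s ≥ -l - 1/2, so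
the tail decays with exponent at least 2r + l + 5/2, more than the 2r - l + 1 required. -/
lemma isBigO_deriv_hurwitzTail (l r : ℕ) :
    (fun z : ℂ => deriv (fun t => hurwitzTail (r + l + 2) t z) (-(l : ℂ)))
      =O[Bornology.cobounded ℂ ⊓ 𝓟 {z : ℂ | 0 < z.re}]
        fun z : ℂ => ‖z‖ ^ (-(2 * (r : ℤ) - (l : ℤ) + 1)) := by
  obtain ⟨C, hC0, hC⟩ := exists_norm_hurwitzTail_le (r + l + 2) (l + 1)
  refine IsBigO.of_bound (C / (1 / 2)) ?_
  filter_upwards [eventually_norm_ge_re_pos 1] with z ⟨hz1, hz⟩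
  have hball : ∀ s ∈ Metric.closedBall (-(l : ℂ)) (1 / 2),
      ‖s‖ ≤ l + 1 ∧ s ≠ 1 ∧ -(l : ℝ) - 1 / 2 ≤ s.re := by
    intro s hs
    rw [mem_closedBall_iff_norm, sub_neg_eq_add] at hs
    have hre := abs_le.mp ((Complex.abs_re_le_norm _).trans hs)
    simp only [Complex.add_re, Complex.natCast_re] at hre
    refine ⟨?_, ?_, by linarith⟩
    · have := norm_sub_le (s + l) (l : ℂ)
      rw [add_sub_cancel_right, Complex.norm_natCast] at this
      linarith
    · rintro rfl
      have : (0 : ℝ) ≤ l := Nat.cast_nonneg l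
      simp only [Complex.one_re] at hre
      linarith
  have hl0 : (0 : ℝ) ≤ l := Nat.cast_nonneg l
  have hr0 : (0 : ℝ) ≤ r := Nat.cast_nonneg r
  have hd : DifferentiableOn ℂ (fun t => hurwitzTail (r + l + 2) t z)
      (Metric.closedBall (-(l : ℂ)) (1 / 2)) := fun s hs => by
    obtain ⟨-, h2, h3⟩ := hball s hs
    refine (differentiableAt_hurwitzTail h2 ?_ hz hz1).differentiableWithinAt
    push_cast; linarith
  have key := Complex.norm_deriv_le_of_forall_mem_sphere_norm_le (by norm_num)
    (hd.diffContOnCl_ball subset_rfl)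
    (C := C * ‖z‖ ^ (-(2 * (r : ℤ) - (l : ℤ) + 1))) fun s hs => by
      obtain ⟨h1, h2, h3⟩ := hball s (Metric.sphere_subset_closedBall hs)
      refine (hC s z h1 h2 (by push_cast; linarith) hz hz1).trans ?_
      refine mul_le_mul_of_nonneg_left ?_ hC0
      rw [← Real.rpow_intCast]
      refine Real.rpow_le_rpow_of_exponent_le hz1 ?_
      push_cast; linarith
  refine key.trans (le_of_eq ?_)
  rw [Real.norm_of_nonneg (by positivity)]
  ring

lemma deriv_hurwitzZetaFun_sub (l r : ℕ) :
    (fun z : ℂ => deriv (fun t : ℂ => hurwitzZetaFun t z) (-(l : ℂ)) - hurwitzDerivExpansion l r z)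
      =ᶠ[Bornology.cobounded ℂ ⊓ 𝓟 {z : ℂ | 0 < z.re}]
        fun z => ∑ j ∈ Finset.Ico r (r + l + 2), hurwitzDerivTerm l j z +
          deriv (fun t => hurwitzTail (r + l + 2) t z) (-(l : ℂ)) := by
  filter_upwards [eventually_norm_ge_re_pos 1] with z ⟨hz1, hz⟩
  have hl1 : -(l : ℂ) ≠ 1 := by
    intro h
    have h' := congrArg Complex.re h
    simp only [Complex.neg_re, Complex.natCast_re, Complex.one_re] at h'
    linarith [Nat.cast_nonneg (α := ℝ) l]
  have hN : 1 < (-(l : ℂ)).re + 2 * ((r + l + 2 : ℕ) : ℝ) := by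
    simp only [Complex.neg_re, Complex.natCast_re]
    push_cast
    linarith [Nat.cast_nonneg (α := ℝ) l, Nat.cast_nonneg (α := ℝ) r]
  have heq : (fun t : ℂ => hurwitzZetaFun t z) =ᶠ[𝓝 (-(l : ℂ))]
      fun t => hurwitzPartialExpansion (r + l + 2) t z + hurwitzTail (r + l + 2) t z := by
    filter_upwards [isOpen_ne.mem_nhds hl1, hurwitzContinuation_eventuallyEq hl1 hN hz hz1]
      with t ht h
    rw [hurwitzZetaFun_eq (isHurwitzContinuation_hurwitzContinuation hz hz1) ht, h]
  have hd := hasDerivAt_hurwitzPartialExpansion l (r + l + 2) (ne_zero_of_re_pos hz)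
  rw [heq.deriv_eq, deriv_fun_add hd.differentiableAt
    (differentiableAt_hurwitzTail hl1 hN hz hz1), hd.deriv, hurwitzDerivExpansion_eq,
    hurwitzDerivExpansion_eq, Finset.sum_Ico_eq_sub _ (by omega)]
  ring

theorem proposition1 (l r : ℕ) :
    (l ≤ 2 * r →
      (fun z : ℂ => deriv (fun t : ℂ => hurwitzZetaFun t z) (-(l : ℂ)) - hurwitzDerivExpansion l r z)
        =O[Bornology.cobounded ℂ ⊓ 𝓟 {z : ℂ | 0 < z.re}]
          fun z : ℂ => ‖z‖ ^ (-(2 * (r : ℤ) - (l : ℤ) + 1))) ∧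
    (2 * r < l →
      (fun z : ℂ => deriv (fun t : ℂ => hurwitzZetaFun t z) (-(l : ℂ)) - hurwitzDerivExpansion l r z)
        =O[Bornology.cobounded ℂ ⊓ 𝓟 {z : ℂ | 0 < z.re}]
          fun z : ℂ => ‖z‖ ^ (-(2 * (r : ℤ) - (l : ℤ) + 1)) * Real.log ‖z‖) := by
  refine ⟨fun h => ?_, fun _ => ?_⟩
  · refine (deriv_hurwitzZetaFun_sub l r).trans_isBigO ?_
    exact (IsBigO.fun_sum fun j hj => isBigO_hurwitzDerivTerm (Finset.mem_Ico.mp hj).1 h).add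
      (isBigO_deriv_hurwitzTail l r)
  · refine (deriv_hurwitzZetaFun_sub l r).trans_isBigO ?_
    refine (IsBigO.fun_sum fun j hj =>
      isBigO_hurwitzDerivTerm_log (Finset.mem_Ico.mp hj).1).add ?_
    -- The tail needs no logarithm; it is inserted through 1 = O(log |z|).
    simpa using (isBigO_deriv_hurwitzTail l r).mul (isBigO_const_log_norm 1)
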